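/- Let $\mathbb{R}^+=[0,+\infty)$. Let $K:\mathbb{R}\to\mathbb{R}$ satisfy: 1) $K(x)>0$ and $K(-x)=K(x)$ for all $x\in\mathbb{R}$, and $K$ is continuously differentiable and bounded on $\mathbb{R}$ together with its first derivative; 2) $K$ is monotonically decreasing (not necessarily strictly) on $\mathbb{R}^+$ and $\int_0^\infty K(t)\,dt=\frac12$; 3) $\int_0^\infty xK(x)\,dx<+\infty$. Let $\omega_1:\mathbb{R}^+\times\mathbb{R}^+\to\mathbb{R}$ satisfy $\omega_1(t,0)=0$ for all $t\in\mathbb{R}^+$ and: $a_1)$ $\omega_1$ is continuous on $\mathbb{R}^+\times\mathbb{R}^+$ and, for each fixed $t\in\mathbb{R}^+$, $u\mapsto\omega_1(t,u)$ is monotonically increasing (not necessarily strictly) on $\mathbb{R}^+$; $a_2)$ for each $t\in\mathbb{R}^+$ the supremum $\mu_1(t):=\sup_{u\in\mathbb{R}^+}\omega_1(t,u)$ is finite, $\mu_1$ is continuous on $\mathbb{R}^+$, $\mu_1(t)\to0$ as $t\to+\infty$, and $\int_0^\infty t\,\mu_1(t)\,dt<+\infty$. Then there are a function $\psi:\mathbb{R}^+\to\mathbb{R}$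 and a one-parameter family of functions $f_\gamma:\mathbb{R}^+\to\mathbb{R}$, $\gamma\in(0,+\infty)$, such that all the integrals below converge absolutely and: (i) for every $\gamma>0$, $f_\gamma$ is a non-negative continuous solution of the quasilinear equation $$f(x)=\int_0^\infty\big(K(x-t)-K(x+t)\big)\big(f(t)+\omega_1(t,f(t))\big)\,dt,\qquad x\in\mathbb{R}^+;$$ (ii) for every $\gamma>0$, $\lim_{x\to+\infty}f_\gamma(x)/x=\gamma$; (iii) $\psi$, which does not depend on $\gamma$, is a non-negative, bounded and continuous solution of the linear equation $$\psi(x)=\int_0^\infty\big(K(x-t)-K(x+t)\big)\mu_1(t)\,dt+\int_0^\infty\big(K(x-t)-K(x+t)\big)\psi(t)\,dt,\qquad x\in\mathbb{R}^+,$$ and $\gamma x\le f_\gamma(x)\le\gamma x+\psi(x)$ for all $\gamma>0$ and $x\in\mathbb{R}^+$; (iv) $f_{\gamma_1}(x)-f_{\gamma_2}(x)\ge(\gamma_1-\gamma_2)x$ for all $\gamma_1>\gamma_2>0$ and $x\in\mathbb{R}^+$. -/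

import Mathlib

open Set Filter Topology MeasureTheory

noncomputable section

/-- The hypotheses on the kernel `K : ℝ → ℝ`: positive, even, continuously differentiable, bounded
together with its first derivative, decreasing on `[0, ∞)`, with `∫₀^∞ K = 1/2` and a finite first
moment. -/
structure IsAdmissibleKernel (K : ℝ → ℝ) : Prop where
  pos : ∀ x, 0 < K x
  even : ∀ x, K (-x) = K x
  contDiff : ContDiff ℝ 1 K
  bounded : ∃ C, ∀ x, |K x| ≤ C
  deriv_bounded : ∃ C, ∀ x, |deriv K x| ≤ C
  antitoneOn : AntitoneOn K (Ici 0)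
  integrableOn : IntegrableOn K (Ioi 0)
  integral_eq : ∫ t in Ioi (0 : ℝ), K t = 1 / 2
  moment : IntegrableOn (fun x => x * K x) (Ioi 0)

/-- The hypotheses on the nonlinearity `ω(t, u)`, `t, u ≥ 0`, together with its supremum
`μ(t) = sup_{u ≥ 0} ω(t, u)`. Only the values of `ω` and `μ` at non-negative arguments matter. -/
structure IsAdmissibleNonlinearity (ω : ℝ → ℝ → ℝ) (μ : ℝ → ℝ) : Prop where
  zero : ∀ t, 0 ≤ t → ω t 0 = 0
  continuousOn : ContinuousOn (fun p : ℝ × ℝ => ω p.1 p.2) (Ici 0 ×ˢ Ici 0)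
  monotoneOn : ∀ t, 0 ≤ t → MonotoneOn (ω t) (Ici 0)
  isLUB : ∀ t, 0 ≤ t → IsLUB (ω t '' Ici 0) (μ t)
  sup_continuousOn : ContinuousOn μ (Ici 0)
  sup_tendsto : Tendsto μ atTop (𝓝 0)
  sup_moment : IntegrableOn (fun t => t * μ t) (Ioi 0)

/-- The integrand `(K(x - t) - K(x + t)) h(t)`. -/
def sumDiffIntegrand (K h : ℝ → ℝ) (x t : ℝ) : ℝ := (K (x - t) - K (x + t)) * h t

/-- `y x = ∫₀^∞ (K(x - t) - K(x + t)) h(t) dt` for every `x ≥ 0`, the integrals being convergent. -/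
def IsSumDiffTransform (K h y : ℝ → ℝ) : Prop :=
  ∀ x, 0 ≤ x → IntegrableOn (sumDiffIntegrand K h x) (Ioi 0) ∧
    y x = ∫ t in Ioi (0 : ℝ), sumDiffIntegrand K h x t

/-- `f` is a non-negative continuous solution on `[0, ∞)` of
`f(x) = ∫₀^∞ (K(x - t) - K(x + t)) (f(t) + ω(t, f(t))) dt`. -/
structure IsQuasilinearSolution (K : ℝ → ℝ) (ω : ℝ → ℝ → ℝ) (f : ℝ → ℝ) : Prop where
  nonneg : ∀ x, 0 ≤ x → 0 ≤ f x
  continuousOn : ContinuousOn f (Ici 0)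
  equation : IsSumDiffTransform K (fun t => f t + ω t (f t)) f

/-- `ψ` is a non-negative bounded continuous solution on `[0, ∞)` of the linear equation
`ψ(x) = g(x) + ∫₀^∞ (K(x - t) - K(x + t)) ψ(t) dt` with free term
`g(x) = ∫₀^∞ (K(x - t) - K(x + t)) μ(t) dt`. -/
structure IsLinearMajorant (K μ ψ : ℝ → ℝ) : Prop where
  nonneg : ∀ x, 0 ≤ x → 0 ≤ ψ x
  continuousOn : ContinuousOn ψ (Ici 0)
  bounded : ∃ C, ∀ x, 0 ≤ x → ψ x ≤ C
  equation : ∃ g : ℝ → ℝ, IsSumDiffTransform K μ g ∧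
    IsSumDiffTransform K ψ (fun x => ψ x - g x)

end

/-!
Let `T h (x) = ∫₀^∞ (K(x - t) - K(x + t)) h(t) dt`. Since `K` is even and decreasing on `[0, ∞)`,
the kernel of `T` is non-negative on the half-line, so `T` is monotone. On odd functions `T` is
convolution with `K` over the whole line; as `∫ K = 1`, linear functions `γ x` are fixed by `T`
(`IsAdmissibleKernel.sumDiffOp_linear`).

Suppose a bounded `ψ ≥ 0` with `ψ = T(ψ + μ)` is known. Then `γ x` is a subsolution of the
quasilinear equation because `ω ≥ 0`, and `γ x + ψ` is a supersolution because `ω ≤ μ` and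
`T(γ t + ψ + μ) = γ x + ψ`. The successive approximations starting from `γ x` increase to a solution
between the two (`IsMonotoneScheme.isQuasilinearSolution`), and `ψ` being bounded this solution is
asymptotic to `γ x`. Comparing the approximations for two values of `γ` step by step, with the
monotonicity of `ω` and `T(a t) = a x`, gives the last inequality
(`IsMonotoneScheme.linear_le_limit_sub`). The function `ψ` is itself the limit of such a scheme, for
the nonlinearity `μ(t)` independent of the unknown, started from `0`. What this scheme needs is a
bounded supersolution `U ≥ T(U + μ)`.

The supersolution (`IsAdmissibleKernel.exists_linear_supersolution`) is the heart of the matter. The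
difficulty is that `T` is conservative, and `K` may have infinite variance and an irregular tail. It
is sought as a potential `U(x) = ∫₀^∞ min(x, s) ν(s) ds`, which is bounded as soon as
`∫ s ν(s) ds < ∞`. Each `min(·, s)` is concave on the half-line with an odd
extension, hence is a supersolution, and near its kink the defect is strict (`IsAdmissibleKernel.sumDiffOp_min_add_le`).
Integrated over `s`, this gives `U - T U ≥ K(3) min(1, x) ∫_x^{x+1} ν`. So `ν` has to dominate
`T μ (x) / min(1, x)` on windows of length one and have a finite first moment. For `x ≥ 1` the
convolution of `μ` with the majorant `K(max(|·| - 1, 0))` does this; for `x ≤ 1` a constant on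
`[0, 2]` does, since `K` is Lipschitz and thus `T μ (x) = O(x)`.
-/

/-! ### The kernel and its translates -/

/-- The half-line operator `(T h)(x) = ∫₀^∞ (K(x - t) - K(x + t)) h(t) dt`. -/
noncomputable def sumDiffOp (K h : ℝ → ℝ) (x : ℝ) : ℝ :=
  ∫ t in Ioi (0 : ℝ), sumDiffIntegrand K h x t

/-- An even majorant of all the translates `t ↦ K(x ± t)` with `|x| ≤ R`: the kernel with its graph
cut at `0` and pulled apart by `R` on either side. -/
noncomputable def kernelMajorant (K : ℝ → ℝ) (R t : ℝ) : ℝ := K (max (|t| - R) 0)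

/-- The odd extension of `min · s` has non-positive second differences at `x ≥ 0`. -/
lemma clamp_add_clamp_le {x s y : ℝ} (hx : 0 ≤ x) (hs : 0 ≤ s) (hy : 0 ≤ y) :
    max (-s) (min (x + y) s) + max (-s) (min (x - y) s) ≤ 2 * min x s := by
  grind

lemma clamp_add_clamp_add_min_le {x s y : ℝ} (hx : 0 ≤ x) (hxs : x ≤ s) (hs : s ≤ x + 1)
    (hy : 2 ≤ y) :
    max (-s) (min (x + y) s) + max (-s) (min (x - y) s) + min 1 x ≤ 2 * min x s := by
  grind

namespace IsAdmissibleKernel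

variable {K : ℝ → ℝ}

lemma continuous (hK : IsAdmissibleKernel K) : Continuous K := hK.contDiff.continuous

lemma apply_abs (hK : IsAdmissibleKernel K) (x : ℝ) : K |x| = K x := by
  rcases abs_choice x with h | h <;> rw [h]
  exact hK.even x

lemma apply_le_of_abs_le (hK : IsAdmissibleKernel K) {x y : ℝ} (h : |x| ≤ |y|) : K y ≤ K x := by
  rw [← hK.apply_abs x, ← hK.apply_abs y]
  exact hK.antitoneOn (abs_nonneg x) (abs_nonneg y) h

lemma sub_nonneg (hK : IsAdmissibleKernel K) {x t : ℝ} (hx : 0 ≤ x) (ht : 0 ≤ t) :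
    0 ≤ K (x - t) - K (x + t) := by
  have : |x - t| ≤ |x + t| := by
    rw [abs_of_nonneg (add_nonneg hx ht), abs_le]
    constructor <;> linarith
  linarith [hK.apply_le_of_abs_le this]

lemma exists_sub_le (hK : IsAdmissibleKernel K) :
    ∃ L, 0 ≤ L ∧ ∀ x t : ℝ, 0 ≤ x → K (x - t) - K (x + t) ≤ L * x := by
  obtain ⟨C, hC⟩ := hK.deriv_bounded
  refine ⟨C * 2, mul_nonneg ((abs_nonneg _).trans (hC 0)) (by norm_num), fun x t hx => ?_⟩
  have h := convex_univ.norm_image_sub_le_of_norm_deriv_le (f := K) (C := C) (x := t - x)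
    (y := x + t) (fun z _ => (hK.contDiff.differentiable one_ne_zero) z) (fun z _ => hC z)
    (mem_univ _) (mem_univ _)
  have e : K (x - t) = K (t - x) := by rw [← hK.even]; congr 1; ring
  have e' : x + t - (t - x) = 2 * x := by ring
  rw [e', Real.norm_eq_abs, Real.norm_eq_abs, abs_of_nonneg (by positivity : 0 ≤ 2 * x)] at h
  rw [e]
  linarith [neg_abs_le (K (x + t) - K (t - x))]

lemma integrable_one_add_abs_mul (hK : IsAdmissibleKernel K) :
    Integrable (fun t => (1 + |t|) * K t) := by
  have h1 : IntegrableOn (fun t => (1 + |t|) * K t) (Ioi 0) := by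
    refine (hK.integrableOn.add hK.moment).congr_fun (fun t ht => ?_) measurableSet_Ioi
    simp only [Pi.add_apply, abs_of_pos (mem_Ioi.1 ht)]
    ring
  have h2 : IntegrableOn (fun t => (1 + |t|) * K t) (Iic 0) := by
    rw [← Measure.map_neg_eq_self (volume : Measure ℝ)]
    have m : MeasurableEmbedding fun x : ℝ => -x := (Homeomorph.neg ℝ).measurableEmbedding
    rw [m.integrableOn_map_iff]
    simp_rw [Function.comp_def, abs_neg, hK.even, neg_preimage, neg_Iic, neg_zero]
    exact Iff.mpr integrableOn_Ici_iff_integrableOn_Ioi h1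
  rw [← integrableOn_univ, ← Iic_union_Ioi (a := (0 : ℝ))]
  exact h2.union h1

lemma continuous_kernelMajorant (hK : IsAdmissibleKernel K) (R : ℝ) :
    Continuous (kernelMajorant K R) :=
  hK.continuous.comp (by fun_prop)

lemma kernelMajorant_pos (hK : IsAdmissibleKernel K) (R t : ℝ) : 0 < kernelMajorant K R t :=
  hK.pos _

lemma le_kernelMajorant (hK : IsAdmissibleKernel K) {R y t : ℝ} (h : |t| - R ≤ |y|) :
    K y ≤ kernelMajorant K R t := by
  refine hK.apply_le_of_abs_le ?_
  rw [abs_of_nonneg (le_max_right _ _)]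
  exact max_le h (abs_nonneg y)

lemma integrable_kernelMajorant (hK : IsAdmissibleKernel K) {R : ℝ} (hR : 0 ≤ R) :
    Integrable (fun t => (1 + |t|) * kernelMajorant K R t) := by
  have h0 : Integrable (fun t => (1 + R) * ((1 + |t|) * K t)) :=
    hK.integrable_one_add_abs_mul.const_mul _
  have h1 := h0.comp_sub_right R
  have h2 := h0.comp_add_right R
  have h3 : Integrable ((Icc (-R) R).indicator fun _ => (1 + R) * K 0) :=
    (integrableOn_const (by simp)).integrable_indicator measurableSet_Icc
  refine ((h1.add h2).add h3).mono'
    ((by fun_prop : Continuous fun t : ℝ => 1 + |t|).mul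
      (hK.continuous_kernelMajorant R)).aestronglyMeasurable (ae_of_all _ fun t => ?_)
  rw [Real.norm_of_nonneg (mul_nonneg (by positivity) (hK.kernelMajorant_pos R t).le)]
  have p1 : 0 ≤ (1 + R) * ((1 + |t - R|) * K (t - R)) := by have := hK.pos (t - R); positivity
  have p2 : 0 ≤ (1 + R) * ((1 + |t + R|) * K (t + R)) := by have := hK.pos (t + R); positivity
  have p3 : 0 ≤ (Icc (-R) R).indicator (fun _ => (1 + R) * K 0) t :=
    indicator_nonneg (fun _ _ => by have := hK.pos 0; positivity) t
  simp only [Pi.add_apply]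
  by_cases ht : t ∈ Icc (-R) R
  · have e : kernelMajorant K R t = K 0 := by
      rw [kernelMajorant, max_eq_right (by linarith [abs_le.2 ht])]
    rw [indicator_of_mem ht] at p3 ⊢
    rw [e]
    have : (1 + |t|) * K 0 ≤ (1 + R) * K 0 :=
      mul_le_mul_of_nonneg_right (by linarith [abs_le.2 ht]) (hK.pos 0).le
    linarith
  · have key : ∀ s : ℝ, |t| ≤ R + |s| → kernelMajorant K R t = K s →
        (1 + |t|) * kernelMajorant K R t ≤ (1 + R) * ((1 + |s|) * K s) := by
      intro s hs e
      rw [e, ← mul_assoc]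
      refine mul_le_mul_of_nonneg_right ?_ (hK.pos s).le
      nlinarith [abs_nonneg s, mul_nonneg hR (abs_nonneg s)]
    have hR' : R < |t| := by
      by_contra h
      exact ht (abs_le.1 (not_lt.1 h))
    rcases le_total 0 t with h | h
    · rw [abs_of_nonneg h] at hR'
      have := key (t - R) (by rw [abs_of_nonneg h, abs_of_pos (by linarith)]; linarith)
        (by rw [kernelMajorant, abs_of_nonneg h, max_eq_left (by linarith)])
      linarith
    · rw [abs_of_nonpos h] at hR'
      have := key (t + R) (by rw [abs_of_nonpos h, abs_of_neg (by linarith)]; linarith)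
        (by rw [kernelMajorant, abs_of_nonpos h, max_eq_left (by linarith), ← hK.even]
            congr 1; ring)
      linarith

/-! ### The half-line operator on functions of at most linear growth -/

lemma abs_sumDiffIntegrand_le (hK : IsAdmissibleKernel K) {R x t C : ℝ} {h : ℝ → ℝ}
    (hx : |x| ≤ R) (ht : |h t| ≤ C * (1 + |t|)) :
    |sumDiffIntegrand K h x t| ≤ C * ((1 + |t|) * kernelMajorant K R t) := by
  have h1 : K (x - t) ≤ kernelMajorant K R t :=
    hK.le_kernelMajorant (by
      have := abs_sub_abs_le_abs_sub t x
      rw [abs_sub_comm] at this; linarith)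
  have h2 : K (x + t) ≤ kernelMajorant K R t :=
    hK.le_kernelMajorant (by
      have := abs_sub_abs_le_abs_sub t (-x)
      rw [abs_neg, sub_neg_eq_add, add_comm t] at this; linarith)
  have h3 : |K (x - t) - K (x + t)| ≤ kernelMajorant K R t :=
    abs_le.2 ⟨by linarith [hK.pos (x - t)], by linarith [hK.pos (x + t)]⟩
  rw [sumDiffIntegrand, abs_mul, ← mul_assoc, mul_comm]
  exact mul_le_mul ht h3 (abs_nonneg _) ((abs_nonneg _).trans ht)

lemma aestronglyMeasurable_sumDiffIntegrand (hK : IsAdmissibleKernel K) {h : ℝ → ℝ}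
    (hm : AEStronglyMeasurable h (volume.restrict (Ioi 0))) (x : ℝ) :
    AEStronglyMeasurable (sumDiffIntegrand K h x) (volume.restrict (Ioi 0)) :=
  ((hK.continuous.comp (by fun_prop : Continuous fun t => x - t)).sub
    (hK.continuous.comp (by fun_prop : Continuous fun t => x + t))).aestronglyMeasurable.mul hm

lemma integrableOn_sumDiffIntegrand (hK : IsAdmissibleKernel K) {h : ℝ → ℝ} {C : ℝ}
    (hm : AEStronglyMeasurable h (volume.restrict (Ioi 0)))
    (hb : ∀ t, 0 < t → |h t| ≤ C * (1 + |t|)) (x : ℝ) :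
    IntegrableOn (sumDiffIntegrand K h x) (Ioi 0) := by
  refine Integrable.mono'
    ((hK.integrable_kernelMajorant (abs_nonneg x)).const_mul C).integrableOn
    (hK.aestronglyMeasurable_sumDiffIntegrand hm x) ?_
  filter_upwards [ae_restrict_mem measurableSet_Ioi] with t ht
  exact hK.abs_sumDiffIntegrand_le le_rfl (hb t ht)

lemma continuous_sumDiffOp (hK : IsAdmissibleKernel K) {h : ℝ → ℝ} {C : ℝ}
    (hm : AEStronglyMeasurable h (volume.restrict (Ioi 0)))
    (hb : ∀ t, 0 < t → |h t| ≤ C * (1 + |t|)) : Continuous (sumDiffOp K h) := by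
  refine continuous_iff_continuousAt.2 fun x₀ => ?_
  have hR : 0 ≤ |x₀| + 1 := by positivity
  refine continuousAt_of_dominated (F := fun x t => sumDiffIntegrand K h x t)
    (bound := fun t => C * ((1 + |t|) * kernelMajorant K (|x₀| + 1) t))
    (Eventually.of_forall fun x => hK.aestronglyMeasurable_sumDiffIntegrand hm x) ?_
    ((hK.integrable_kernelMajorant hR).const_mul C).integrableOn (ae_of_all _ fun t => ?_)
  · have : ∀ᶠ x in 𝓝 x₀, |x| < |x₀| + 1 :=
      continuous_abs.continuousAt.eventually_lt continuousAt_const (by simp)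
    filter_upwards [this] with x hx
    filter_upwards [ae_restrict_mem measurableSet_Ioi] with t ht
    exact hK.abs_sumDiffIntegrand_le hx.le (hb t ht)
  · unfold sumDiffIntegrand
    have := hK.continuous
    exact Continuous.continuousAt (by fun_prop)

/-- The operator is monotone on `[0, ∞)`, its kernel being non-negative there. -/
lemma sumDiffOp_mono (hK : IsAdmissibleKernel K) {h₁ h₂ : ℝ → ℝ} {x : ℝ} (hx : 0 ≤ x)
    (hi₁ : IntegrableOn (sumDiffIntegrand K h₁ x) (Ioi 0))
    (hi₂ : IntegrableOn (sumDiffIntegrand K h₂ x) (Ioi 0))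
    (hle : ∀ t, 0 < t → h₁ t ≤ h₂ t) : sumDiffOp K h₁ x ≤ sumDiffOp K h₂ x :=
  setIntegral_mono_on hi₁ hi₂ measurableSet_Ioi fun t ht =>
    mul_le_mul_of_nonneg_left (hle t ht) (hK.sub_nonneg hx (le_of_lt ht))

lemma sumDiffOp_congr {h₁ h₂ : ℝ → ℝ} (h : ∀ t, 0 < t → h₁ t = h₂ t) (x : ℝ) :
    sumDiffOp K h₁ x = sumDiffOp K h₂ x :=
  setIntegral_congr_fun measurableSet_Ioi fun t ht => by simp only [sumDiffIntegrand, h t ht]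

lemma integrableOn_sumDiffIntegrand_add {h₁ h₂ : ℝ → ℝ} {x : ℝ}
    (hi₁ : IntegrableOn (sumDiffIntegrand K h₁ x) (Ioi 0))
    (hi₂ : IntegrableOn (sumDiffIntegrand K h₂ x) (Ioi 0)) :
    IntegrableOn (sumDiffIntegrand K (fun t => h₁ t + h₂ t) x) (Ioi 0) := by
  refine (hi₁.add hi₂).congr_fun (fun t _ => ?_) measurableSet_Ioi
  simp only [Pi.add_apply, sumDiffIntegrand]
  ring

lemma sumDiffOp_add {h₁ h₂ : ℝ → ℝ} {x : ℝ}
    (hi₁ : IntegrableOn (sumDiffIntegrand K h₁ x) (Ioi 0))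
    (hi₂ : IntegrableOn (sumDiffIntegrand K h₂ x) (Ioi 0)) :
    sumDiffOp K (fun t => h₁ t + h₂ t) x = sumDiffOp K h₁ x + sumDiffOp K h₂ x := by
  rw [sumDiffOp, sumDiffOp, sumDiffOp, ← integral_add hi₁ hi₂]
  congr 1
  ext t
  simp only [sumDiffIntegrand]
  ring

/-- On odd functions the operator is convolution with `K` over the whole line; grouping the steps
`± y` of the convolution gives this formula. -/
lemma sumDiffOp_of_odd (hK : IsAdmissibleKernel K) {h : ℝ → ℝ} {C : ℝ} (hc : Continuous h)
    (hodd : ∀ t, h (-t) = -h t) (hb : ∀ t, |h t| ≤ C * (1 + |t|)) (x : ℝ) :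
    IntegrableOn (fun y => K y * (h (x + y) + h (x - y))) (Ioi 0) ∧
    sumDiffOp K h x = ∫ y in Ioi (0 : ℝ), K y * (h (x + y) + h (x - y)) := by
  have hKc := hK.continuous
  -- the convolution integrand is integrable on the whole line
  have hI : Integrable (fun t => K (x - t) * h t) := by
    refine ((hK.integrable_kernelMajorant (abs_nonneg x)).const_mul C).mono'
      (by fun_prop : Continuous _).aestronglyMeasurable (ae_of_all _ fun t => ?_)
    have h1 : K (x - t) ≤ kernelMajorant K |x| t :=
      hK.le_kernelMajorant (by rw [abs_sub_comm]; exact abs_sub_abs_le_abs_sub t x)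
    rw [Real.norm_eq_abs, abs_mul, abs_of_pos (hK.pos _), ← mul_assoc, mul_comm]
    exact mul_le_mul (hb t) h1 (hK.pos _).le ((abs_nonneg _).trans (hb t))
  have split : ∀ F : ℝ → ℝ, Integrable F → ∫ t, F t = ∫ t in Ioi (0 : ℝ), (F t + F (-t)) := by
    intro F hF
    rw [integral_add hF.integrableOn hF.comp_neg.integrableOn, integral_comp_neg_Ioi, neg_zero,
      add_comm]
    exact (intervalIntegral.integral_Iic_add_Ioi hF.integrableOn hF.integrableOn).symm
  have hJ : Integrable (fun y => K y * h (x - y)) := by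
    have := hI.comp_sub_left x
    simpa using this
  have e : ∫ t, K (x - t) * h t = ∫ y, K y * h (x - y) := by
    rw [← integral_sub_left_eq_self (fun t => K (x - t) * h t) volume x]
    simp
  have hJ' : ∀ y, K y * h (x - y) + K (-y) * h (x - -y) = K y * (h (x + y) + h (x - y)) := by
    intro y
    rw [hK.even, sub_neg_eq_add]; ring
  refine ⟨?_, ?_⟩
  · have := (hJ.add hJ.comp_neg).integrableOn (s := Ioi 0)
    refine this.congr_fun (fun y _ => hJ' y) measurableSet_Ioi
  · have e1 := split _ hI
    have e2 := split _ hJ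
    rw [sumDiffOp]
    rw [e1, e2] at e
    simp only [hJ'] at e
    rw [← e]
    congr 1
    ext t
    rw [sumDiffIntegrand, hodd, sub_neg_eq_add]; ring

/-- Linear functions are fixed by the operator. -/
lemma sumDiffOp_linear (hK : IsAdmissibleKernel K) (a x : ℝ) :
    sumDiffOp K (fun t => a * t) x = a * x := by
  rw [(hK.sumDiffOp_of_odd (C := |a|) (by fun_prop) (fun t => by ring) (fun t => by
    rw [abs_mul]; nlinarith [abs_nonneg a, abs_nonneg t]) x).2]
  have : ∀ y, K y * (a * (x + y) + a * (x - y)) = K y * (2 * (a * x)) := fun y => by ring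
  simp only [this]
  rw [integral_mul_const, hK.integral_eq]
  ring

/-- The truncated linear functions `t ↦ min t s` are strict supersolutions near their kink: a step
of length between `2` and `3` in both directions loses at least `min 1 x` from the second
difference. -/
lemma sumDiffOp_min_add_le (hK : IsAdmissibleKernel K) {x s : ℝ} (hx : 0 ≤ x) (hs : 0 ≤ s) :
    sumDiffOp K (fun t => min t s) x + (Icc x (x + 1)).indicator (fun _ => K 3 * min 1 x) s
      ≤ min x s := by
  set δ : ℝ := (Icc x (x + 1)).indicator (fun _ => min 1 x) s with hδ
  have hδ' : (Icc x (x + 1)).indicator (fun _ => K 3 * min 1 x) s = K 3 * δ := by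
    rw [hδ]; by_cases h : s ∈ Icc x (x + 1) <;> simp [h]
  have hδ0 : 0 ≤ δ := indicator_nonneg (fun _ _ => by positivity) s
  -- the odd extension of `min · s`
  set h : ℝ → ℝ := fun t => max (-s) (min t s) with hh
  have hhs : ∀ t, |h t| ≤ s := fun t => abs_le.2 ⟨le_max_left _ _, by grind⟩
  have hodd := hK.sumDiffOp_of_odd (h := h) (C := s) (by fun_prop) (fun t => by grind)
    (fun t => (hhs t).trans (by nlinarith [abs_nonneg t])) x
  have e : sumDiffOp K (fun t => min t s) x = sumDiffOp K h x :=
    sumDiffOp_congr (fun t ht => by grind) x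
  rw [hδ', e, hodd.2]
  have hind : IntegrableOn ((Ioc (2 : ℝ) 3).indicator fun _ => K 3 * δ) (Ioi 0) :=
    ((integrableOn_const (by simp)).integrable_indicator measurableSet_Ioc).integrableOn
  have hval : ∫ y in Ioi (0 : ℝ), (Ioc (2 : ℝ) 3).indicator (fun _ => K 3 * δ) y = K 3 * δ := by
    rw [setIntegral_indicator measurableSet_Ioc,
      inter_eq_right.2 (show Ioc (2 : ℝ) 3 ⊆ Ioi 0 from fun y hy => lt_trans two_pos hy.1),
      setIntegral_const, Measure.real, Real.volume_Ioc]
    norm_num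
  have hmain := setIntegral_mono_on (hodd.1.add hind)
    (hK.integrableOn.mul_const (2 * min x s)) measurableSet_Ioi (fun y hy => by
      have hy0 : 0 ≤ y := le_of_lt hy
      simp only [Pi.add_apply]
      by_cases hm : y ∈ Ioc (2 : ℝ) 3
      · rw [indicator_of_mem hm]
        have h3 : K 3 ≤ K y := hK.apply_le_of_abs_le (by
          rw [abs_of_nonneg hy0, abs_of_pos (by norm_num : (0 : ℝ) < 3)]; exact hm.2)
        have hsum : h (x + y) + h (x - y) + δ ≤ 2 * min x s := by
          by_cases hsx : s ∈ Icc x (x + 1)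
          · rw [hδ, indicator_of_mem hsx]
            exact clamp_add_clamp_add_min_le hx hsx.1 hsx.2 hm.1.le
          · rw [hδ, indicator_of_notMem hsx, add_zero]
            exact clamp_add_clamp_le hx hs hy0
        have := mul_le_mul_of_nonneg_left hsum (hK.pos y).le
        nlinarith [mul_le_mul_of_nonneg_right h3 hδ0]
      · rw [indicator_of_notMem hm, add_zero]
        exact mul_le_mul_of_nonneg_left (clamp_add_clamp_le hx hs hy0) (hK.pos y).le)
  rw [integral_mul_const, hK.integral_eq] at hmain
  have hadd := integral_add hodd.1 hind
  rw [hval] at hadd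
  simp only [Pi.add_apply] at hmain
  linarith

end IsAdmissibleKernel

/-! ### A bounded supersolution of the linear equation -/

/-- The half-line operator on functions with values in `[0, ∞]`; its kernel is non-negative for
`x ≥ 0`, the only arguments that are used. -/
noncomputable def lintegralSumDiffOp (K : ℝ → ℝ) (h : ℝ → ENNReal) (x : ℝ) : ENNReal :=
  ∫⁻ t in Ioi (0 : ℝ), ENNReal.ofReal (K (x - t) - K (x + t)) * h t

/-- The potential `x ↦ ∫₀^∞ min(x, s) ν(s) ds` of a density `ν`, with respect to the Green function
`min(x, s)` of `-d²/dx²` on the half-line with Dirichlet condition at `0`. -/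
noncomputable def greenPotential (ν : ℝ → ENNReal) (x : ℝ) : ENNReal :=
  ∫⁻ s in Ioi (0 : ℝ), ENNReal.ofReal (min x s) * ν s

lemma measurable_greenPotential {ν : ℝ → ENNReal} (hν : Measurable ν) :
    Measurable (greenPotential ν) := by
  refine Measurable.lintegral_prod_right'
    (f := fun p : ℝ × ℝ => ENNReal.ofReal (min p.1 p.2) * ν p.2) ?_
  fun_prop

namespace IsAdmissibleKernel

variable {K : ℝ → ℝ}

lemma lintegralSumDiffOp_ofReal (hK : IsAdmissibleKernel K) {h : ℝ → ℝ} {x : ℝ} (hx : 0 ≤ x)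
    (h0 : ∀ t, 0 < t → 0 ≤ h t) (hi : IntegrableOn (sumDiffIntegrand K h x) (Ioi 0)) :
    lintegralSumDiffOp K (fun t => ENNReal.ofReal (h t)) x = ENNReal.ofReal (sumDiffOp K h x) := by
  rw [sumDiffOp, ofReal_integral_eq_lintegral_ofReal hi]
  · refine setLIntegral_congr_fun measurableSet_Ioi fun t ht => ?_
    simp only [sumDiffIntegrand]
    rw [ENNReal.ofReal_mul (hK.sub_nonneg hx (le_of_lt ht))]
  · filter_upwards [ae_restrict_mem measurableSet_Ioi] with t ht
    exact mul_nonneg (hK.sub_nonneg hx (le_of_lt ht)) (h0 t ht)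

/-- The superposition of `sumDiffOp_min_add_le` over `s`: potentials are supersolutions, with a
quantitative defect controlled from below by the mass of the density in `[x, x + 1]`. -/
lemma lintegralSumDiffOp_greenPotential_add_le (hK : IsAdmissibleKernel K) {ν : ℝ → ENNReal}
    (hν : Measurable ν) {x : ℝ} (hx : 0 ≤ x) :
    lintegralSumDiffOp K (greenPotential ν) x +
      ENNReal.ofReal (K 3 * min 1 x) * ∫⁻ s in Icc x (x + 1), ν s ≤ greenPotential ν x := by
  have hKm : Measurable K := hK.continuous.measurable
  have e1 : lintegralSumDiffOp K (greenPotential ν) x =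
      ∫⁻ s in Ioi (0 : ℝ), lintegralSumDiffOp K (fun t => ENNReal.ofReal (min t s)) x * ν s := by
    have : ∀ t, ENNReal.ofReal (K (x - t) - K (x + t)) * greenPotential ν t =
        ∫⁻ s in Ioi (0 : ℝ),
          ENNReal.ofReal (K (x - t) - K (x + t)) * (ENNReal.ofReal (min t s) * ν s) := fun t => by
      rw [greenPotential, lintegral_const_mul _ (by fun_prop)]
    rw [lintegralSumDiffOp]
    simp only [this]
    rw [lintegral_lintegral_swap (by fun_prop)]
    refine lintegral_congr fun s => ?_
    rw [lintegralSumDiffOp, ← lintegral_mul_const _ (by fun_prop)]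
    simp only [mul_assoc]
  have e2 : ENNReal.ofReal (K 3 * min 1 x) * ∫⁻ s in Icc x (x + 1), ν s ≤
      ∫⁻ s in Ioi (0 : ℝ),
        (Icc x (x + 1)).indicator (fun s => ENNReal.ofReal (K 3 * min 1 x) * ν s) s := by
    rw [setLIntegral_indicator measurableSet_Icc, ← lintegral_const_mul _ hν]
    refine (setLIntegral_mono_ae' measurableSet_Icc ?_).trans
      (lintegral_mono' (Measure.restrict_mono_ae ?_) le_rfl) (b := ∫⁻ s in Icc x (x + 1), _)
    · exact ae_of_all _ fun s _ => le_rfl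
    · have h0 : ∀ᵐ s : ℝ, s ≠ x := by simp [ae_iff]
      filter_upwards [h0] with s hs hmem
      exact ⟨hmem, lt_of_le_of_lt hx (lt_of_le_of_ne hmem.1 (Ne.symm hs))⟩
  rw [e1]
  refine (add_le_add le_rfl e2).trans ?_
  rw [← lintegral_add_right _
    (Measurable.indicator (by fun_prop) measurableSet_Icc), greenPotential]
  refine setLIntegral_mono' measurableSet_Ioi fun s hs => ?_
  have hs0 : 0 ≤ s := le_of_lt hs
  have hi := hK.integrableOn_sumDiffIntegrand (h := fun t => min t s) (C := 1)
    (by fun_prop : Continuous fun t => min t s).aestronglyMeasurable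
    (fun t ht => by
      rw [abs_of_nonneg (le_min ht.le hs0), abs_of_pos ht]; linarith [min_le_left t s]) x
  rw [hK.lintegralSumDiffOp_ofReal hx (fun t ht => le_min ht.le hs0) hi]
  have e3 : (Icc x (x + 1)).indicator (fun s => ENNReal.ofReal (K 3 * min 1 x) * ν s) s =
      ENNReal.ofReal ((Icc x (x + 1)).indicator (fun _ => K 3 * min 1 x) s) * ν s := by
    by_cases h : s ∈ Icc x (x + 1) <;> simp [h]
  have n1 : 0 ≤ sumDiffOp K (fun t => min t s) x :=
    setIntegral_nonneg measurableSet_Ioi fun t ht =>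
      mul_nonneg (hK.sub_nonneg hx (le_of_lt ht)) (le_min (le_of_lt ht) hs0)
  have n2 : 0 ≤ (Icc x (x + 1)).indicator (fun _ => K 3 * min 1 x) s :=
    indicator_nonneg (fun _ _ => mul_nonneg (hK.pos 3).le (le_min zero_le_one hx)) s
  rw [e3, ← add_mul, ← ENNReal.ofReal_add n1 n2]
  gcongr
  exact hK.sumDiffOp_min_add_le hx hs0

/-- The density `K(max(|s - t| - 1, 0))`, smeared against `m`, has a finite first moment as soon as
`m` has: convolution with a kernel of finite first moment preserves this property. -/
lemma lintegral_mul_lintegral_kernelMajorant_lt_top (hK : IsAdmissibleKernel K) {m : ℝ → ℝ}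
    (hm : Continuous m) (hi : IntegrableOn (fun t => (1 + t) * m t) (Ioi 0)) :
    ∫⁻ s in Ioi (0 : ℝ), ENNReal.ofReal s *
      ∫⁻ t in Ioi (0 : ℝ), ENNReal.ofReal (kernelMajorant K 1 (s - t)) * ENNReal.ofReal (m t)
      < ⊤ := by
  have hKm : Measurable (kernelMajorant K 1) := (hK.continuous_kernelMajorant 1).measurable
  have hmm := hm.measurable
  set C := ∫⁻ u, ENNReal.ofReal ((1 + |u|) * kernelMajorant K 1 u) with hC
  have hCt : C < ⊤ := (hK.integrable_kernelMajorant zero_le_one).lintegral_lt_top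
  have step : ∫⁻ s in Ioi (0 : ℝ), ENNReal.ofReal s *
      ∫⁻ t in Ioi (0 : ℝ), ENNReal.ofReal (kernelMajorant K 1 (s - t)) * ENNReal.ofReal (m t) ≤
      ∫⁻ t in Ioi (0 : ℝ), C * ENNReal.ofReal ((1 + t) * m t) := by
    have : ∀ s, ENNReal.ofReal s * ∫⁻ t in Ioi (0 : ℝ),
          ENNReal.ofReal (kernelMajorant K 1 (s - t)) * ENNReal.ofReal (m t) =
        ∫⁻ t in Ioi (0 : ℝ), ENNReal.ofReal s *
          (ENNReal.ofReal (kernelMajorant K 1 (s - t)) * ENNReal.ofReal (m t)) := fun s => by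
      rw [lintegral_const_mul _ (by fun_prop)]
    simp only [this]
    rw [lintegral_lintegral_swap (by fun_prop)]
    refine setLIntegral_mono' measurableSet_Ioi fun t ht => ?_
    have ht0 : 0 < t := ht
    rw [ENNReal.ofReal_mul (by positivity), hC,
      ← lintegral_sub_right_eq_self (fun u => ENNReal.ofReal ((1 + |u|) * kernelMajorant K 1 u)) t,
      ← lintegral_mul_const _ (by fun_prop)]
    refine (setLIntegral_mono' measurableSet_Ioi fun s hs => ?_).trans
      (setLIntegral_le_lintegral _ _)
    have hp := (hK.kernelMajorant_pos 1 (s - t)).le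
    rw [← mul_assoc, ← mul_assoc, ← ENNReal.ofReal_mul (le_of_lt hs),
      ← ENNReal.ofReal_mul (show 0 ≤ (1 + |s - t|) * kernelMajorant K 1 (s - t) by positivity)]
    refine mul_le_mul_left (ENNReal.ofReal_le_ofReal ?_) _
    have hst : s ≤ (1 + |s - t|) * (1 + t) := by
      nlinarith [le_abs_self (s - t), mul_nonneg (abs_nonneg (s - t)) ht0.le]
    calc s * kernelMajorant K 1 (s - t)
        ≤ (1 + |s - t|) * (1 + t) * kernelMajorant K 1 (s - t) :=
          mul_le_mul_of_nonneg_right hst hp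
      _ = _ := by ring
  refine step.trans_lt ?_
  rw [lintegral_const_mul _ (by fun_prop)]
  exact ENNReal.mul_lt_top hCt hi.lintegral_lt_top

/-- The potential of a suitable density absorbs the free term `T m`. Away from `0`, the density is
`m` smeared by the kernel majorant, which bounds `T m` on whole windows `[x, x + 1]`; close to `0`,
where the defect is only of order `x`, the Lipschitz bound on `K` gives `T m (x) = O(x)`, and a
constant density on `[0, 2]` suffices. -/
lemma exists_linear_supersolution (hK : IsAdmissibleKernel K) {m : ℝ → ℝ} (hm : Continuous m)
    (hm0 : ∀ t, 0 ≤ m t) {B : ℝ} (hB : ∀ t, m t ≤ B)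
    (hi : IntegrableOn (fun t => (1 + t) * m t) (Ioi 0)) :
    ∃ (U : ℝ → ℝ) (M : ℝ), Measurable U ∧ (∀ x, 0 ≤ U x) ∧ (∀ x, U x ≤ M) ∧
      ∀ x, 0 ≤ x → sumDiffOp K (fun t => U t + m t) x ≤ U x := by
  have hmm := hm.measurable
  have hKm : Measurable K := hK.continuous.measurable
  have hKM : Measurable (kernelMajorant K 1) := (hK.continuous_kernelMajorant 1).measurable
  obtain ⟨L, hL0, hL⟩ := hK.exists_sub_le
  have hK3 := hK.pos 3
  set mE : ℝ → ENNReal := fun t => ENNReal.ofReal (m t) with hmE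
  have hmEm : Measurable mE := by fun_prop
  set m₀ := ∫⁻ t in Ioi (0 : ℝ), mE t with hm₀
  have hm₀t : m₀ < ⊤ := by
    refine lt_of_le_of_lt (setLIntegral_mono' measurableSet_Ioi fun t ht => ?_) hi.lintegral_lt_top
    exact ENNReal.ofReal_le_ofReal (by nlinarith [hm0 t, mem_Ioi.1 ht])
  set smear : ℝ → ENNReal := fun s =>
    ∫⁻ t in Ioi (0 : ℝ), ENNReal.ofReal (kernelMajorant K 1 (s - t)) * mE t with hsmear
  have hsm : Measurable smear := by
    refine Measurable.lintegral_prod_right'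
      (f := fun p : ℝ × ℝ => ENNReal.ofReal (kernelMajorant K 1 (p.1 - p.2)) * mE p.2) ?_
    fun_prop
  set A : ENNReal := ENNReal.ofReal ((K 3)⁻¹ * L) * m₀ with hA
  have hAt : A < ⊤ := ENNReal.mul_lt_top ENNReal.ofReal_lt_top hm₀t
  set ν : ℝ → ENNReal := fun s =>
    (Icc (0 : ℝ) 2).indicator (fun _ => A) s + ENNReal.ofReal (K 3)⁻¹ * smear s with hνdef
  have hν : Measurable ν :=
    (measurable_const.indicator measurableSet_Icc).add (hsm.const_mul _)
  -- the potential is bounded by the first moment of its density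
  set M := ∫⁻ s in Ioi (0 : ℝ), ENNReal.ofReal s * ν s with hM
  have hMt : M < ⊤ := by
    have e : ∀ s, ENNReal.ofReal s * ν s = (Icc (0 : ℝ) 2).indicator (fun s => ENNReal.ofReal s * A) s
        + ENNReal.ofReal (K 3)⁻¹ * (ENNReal.ofReal s * smear s) := by
      intro s
      rw [hνdef, mul_add, mul_left_comm]
      congr 1
      by_cases h : s ∈ Icc (0 : ℝ) 2 <;> simp [h]
    simp only [hM, e]
    rw [lintegral_add_right _ (by fun_prop), lintegral_const_mul _ (by fun_prop)]
    refine ENNReal.add_lt_top.2 ⟨?_, ENNReal.mul_lt_top ENNReal.ofReal_lt_top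
      (hK.lintegral_mul_lintegral_kernelMajorant_lt_top hm hi)⟩
    refine (setLIntegral_le_lintegral _ _).trans_lt ?_
    rw [lintegral_indicator measurableSet_Icc]
    refine (setLIntegral_mono' (g := fun _ => ENNReal.ofReal 2 * A) measurableSet_Icc
      fun s hs => ?_).trans_lt ?_
    · gcongr; exact hs.2
    · rw [setLIntegral_const]
      exact ENNReal.mul_lt_top (ENNReal.mul_lt_top ENNReal.ofReal_lt_top hAt) (by simp)
  have hPM : ∀ x, greenPotential ν x ≤ M := fun x => by
    refine lintegral_mono fun s => ?_
    gcongr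
    exact min_le_right x s
  -- the free term is absorbed by the defect
  have hfree : ∀ x, 0 ≤ x → lintegralSumDiffOp K mE x ≤
      ENNReal.ofReal (K 3 * min 1 x) * ∫⁻ s in Icc x (x + 1), ν s := by
    intro x hx
    have vol : volume (Icc x (x + 1)) = 1 := by simp
    have lower : ∀ c : ENNReal, (∀ s ∈ Icc x (x + 1), c ≤ ν s) → c ≤ ∫⁻ s in Icc x (x + 1), ν s := by
      intro c hc
      have := setLIntegral_mono' (μ := volume) (f := fun _ => c) measurableSet_Icc hc
      rwa [setLIntegral_const, vol, mul_one] at this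
    rcases le_total x 1 with h1 | h1
    · have hA' : A ≤ ∫⁻ s in Icc x (x + 1), ν s := lower A fun s hs => by
        rw [hνdef]
        simp only
        rw [indicator_of_mem (show s ∈ Icc (0 : ℝ) 2 from ⟨hx.trans hs.1, by linarith [hs.2]⟩)]
        exact le_self_add
      refine le_trans ?_ (mul_le_mul_right hA' _)
      rw [min_eq_right h1, hA, ← mul_assoc, ← ENNReal.ofReal_mul (by positivity),
        show K 3 * x * ((K 3)⁻¹ * L) = L * x by field_simp, hm₀,
        ← lintegral_const_mul _ hmEm]
      refine lintegral_mono fun t => ?_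
      gcongr
      exact hL x t hx
    · have hS : ENNReal.ofReal (K 3)⁻¹ * lintegralSumDiffOp K mE x ≤
          ∫⁻ s in Icc x (x + 1), ν s := lower _ fun s hs => by
        refine le_trans ?_ (le_add_self (a := ENNReal.ofReal (K 3)⁻¹ * smear s))
        gcongr
        refine lintegral_mono fun t => ?_
        gcongr
        refine le_trans (sub_le_self _ (hK.pos _).le) (hK.le_kernelMajorant ?_)
        have h3 := abs_sub_abs_le_abs_sub (s - t) (x - t)
        rw [show s - t - (x - t) = s - x by ring,
          abs_of_nonneg (show 0 ≤ s - x by linarith [hs.1])] at h3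
        linarith [hs.2]
      refine le_trans ?_ (mul_le_mul_right hS _)
      rw [min_eq_left h1, mul_one, ← mul_assoc, ← ENNReal.ofReal_mul hK3.le,
        mul_inv_cancel₀ hK3.ne', ENNReal.ofReal_one, one_mul]
  -- back to real-valued functions
  have hfin : ∀ x, greenPotential ν x ≠ ⊤ := fun x => ((hPM x).trans_lt hMt).ne
  refine ⟨fun x => (greenPotential ν x).toReal, M.toReal,
    (measurable_greenPotential hν).ennreal_toReal, fun x => ENNReal.toReal_nonneg,
    fun x => ENNReal.toReal_mono hMt.ne (hPM x), fun x hx => ?_⟩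
  have hU0 : ∀ t, 0 ≤ (greenPotential ν t).toReal + m t :=
    fun t => add_nonneg ENNReal.toReal_nonneg (hm0 t)
  have hint := hK.integrableOn_sumDiffIntegrand
    (h := fun t => (greenPotential ν t).toReal + m t) (C := M.toReal + B)
    ((measurable_greenPotential hν).ennreal_toReal.add hmm).aestronglyMeasurable
    (fun t _ => by
      have h1 := ENNReal.toReal_mono hMt.ne (hPM t)
      have h2 := hB t
      rw [abs_of_nonneg (hU0 t)]
      nlinarith [abs_nonneg t, hU0 t]) x
  rw [← ENNReal.ofReal_le_iff_le_toReal (hfin x),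
    ← hK.lintegralSumDiffOp_ofReal hx (fun t _ => hU0 t) hint]
  refine le_trans (le_of_eq ?_)
    ((add_le_add_right (hfree x hx) _).trans
      (hK.lintegralSumDiffOp_greenPotential_add_le hν hx))
  rw [lintegralSumDiffOp, lintegralSumDiffOp, lintegralSumDiffOp,
    ← lintegral_add_right _ (by fun_prop)]
  refine lintegral_congr fun t => ?_
  rw [ENNReal.ofReal_add ENNReal.toReal_nonneg (hm0 t), ENNReal.ofReal_toReal (hfin t), mul_add]

end IsAdmissibleKernel

/-! ### Monotone iteration between a subsolution and a supersolution -/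

/-- The successive approximations `uₙ₊₁ = T(uₙ + w(·, uₙ))` starting from `u₀ = l`. -/
noncomputable def quasilinearIterate (K : ℝ → ℝ) (w : ℝ → ℝ → ℝ) (l : ℝ → ℝ) : ℕ → ℝ → ℝ
  | 0 => l
  | n + 1 => sumDiffOp K fun t => quasilinearIterate K w l n t + w t (quasilinearIterate K w l n t)

/-- The limit of the increasing successive approximations. -/
noncomputable def quasilinearLimit (K : ℝ → ℝ) (w : ℝ → ℝ → ℝ) (l : ℝ → ℝ) (x : ℝ) : ℝ :=
  ⨆ n, quasilinearIterate K w l n x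

/-- The data of a monotone iteration: a nonlinearity `w ≥ 0`, increasing in its second argument, a
subsolution `l`, an upper bound `U`, and a majorant `V` of `u + w(t, u)` for `0 ≤ u ≤ U(t)` with
`T V ≤ U`. Everything grows at most linearly, with the constant `C`. -/
structure IsMonotoneScheme (K : ℝ → ℝ) (w : ℝ → ℝ → ℝ) (l U V : ℝ → ℝ) (C : ℝ) : Prop where
  kernel : IsAdmissibleKernel K
  continuousOn : ContinuousOn (fun p : ℝ × ℝ => w p.1 p.2) (Ici 0 ×ˢ Ici 0)
  monotoneOn : ∀ t, 0 ≤ t → MonotoneOn (w t) (Ici 0)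
  nonneg : ∀ t u, 0 ≤ t → 0 ≤ u → 0 ≤ w t u
  lower_continuousOn : ContinuousOn l (Ici 0)
  lower_nonneg : ∀ t, 0 ≤ t → 0 ≤ l t
  lower_le_upper : ∀ t, 0 ≤ t → l t ≤ U t
  subsolution : ∀ x, 0 ≤ x → l x ≤ sumDiffOp K (fun t => l t + w t (l t)) x
  add_le : ∀ t u, 0 ≤ t → 0 ≤ u → u ≤ U t → u + w t u ≤ V t
  majorant_measurable : AEStronglyMeasurable V (volume.restrict (Ioi 0))
  majorant_le : ∀ t, 0 ≤ t → V t ≤ C * (1 + |t|)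
  supersolution : ∀ x, 0 ≤ x → sumDiffOp K V x ≤ U x

namespace IsMonotoneScheme

variable {K : ℝ → ℝ} {w : ℝ → ℝ → ℝ} {l U V : ℝ → ℝ} {C : ℝ}

lemma continuousOn_add (h : IsMonotoneScheme K w l U V C) {f : ℝ → ℝ}
    (hf : ContinuousOn f (Ici 0)) (hf0 : ∀ t, 0 ≤ t → 0 ≤ f t) :
    ContinuousOn (fun t => f t + w t (f t)) (Ici 0) :=
  hf.add (h.continuousOn.comp (continuousOn_id.prodMk hf) fun t ht => ⟨ht, hf0 t ht⟩)

lemma abs_add_le (h : IsMonotoneScheme K w l U V C) {f : ℝ → ℝ}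
    (hf : ∀ t, 0 ≤ t → 0 ≤ f t ∧ f t ≤ U t) (t : ℝ) (ht : 0 < t) :
    |f t + w t (f t)| ≤ C * (1 + |t|) := by
  have h0 := hf t ht.le
  rw [abs_of_nonneg (add_nonneg h0.1 (h.nonneg t _ ht.le h0.1))]
  exact (h.add_le t _ ht.le h0.1 h0.2).trans (h.majorant_le t ht.le)

lemma abs_majorant_le (h : IsMonotoneScheme K w l U V C) (t : ℝ) (ht : 0 < t) :
    |V t| ≤ C * (1 + |t|) := by
  have hU := (h.lower_nonneg t ht.le).trans (h.lower_le_upper t ht.le)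
  rw [abs_of_nonneg ((add_nonneg le_rfl (h.nonneg t 0 ht.le le_rfl)).trans
    (h.add_le t 0 ht.le le_rfl hU))]
  exact h.majorant_le t ht.le

lemma iterate_mem (h : IsMonotoneScheme K w l U V C) (n : ℕ) :
    ContinuousOn (quasilinearIterate K w l n) (Ici 0) ∧
      ∀ x, 0 ≤ x → 0 ≤ quasilinearIterate K w l n x ∧ quasilinearIterate K w l n x ≤ U x := by
  induction n with
  | zero => exact ⟨h.lower_continuousOn, fun x hx => ⟨h.lower_nonneg x hx, h.lower_le_upper x hx⟩⟩
  | succ n ih =>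
    have hm : AEStronglyMeasurable (fun t => quasilinearIterate K w l n t +
        w t (quasilinearIterate K w l n t)) (volume.restrict (Ioi 0)) :=
      ((h.continuousOn_add ih.1 fun t ht => (ih.2 t ht).1).mono
        Ioi_subset_Ici_self).aestronglyMeasurable measurableSet_Ioi
    refine ⟨(h.kernel.continuous_sumDiffOp hm (h.abs_add_le ih.2)).continuousOn,
      fun x hx => ⟨?_, ?_⟩⟩
    · exact setIntegral_nonneg measurableSet_Ioi fun t ht =>
        mul_nonneg (h.kernel.sub_nonneg hx (le_of_lt ht))
          (add_nonneg (ih.2 t (le_of_lt ht)).1 (h.nonneg t _ (le_of_lt ht) (ih.2 t (le_of_lt ht)).1))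
    · refine le_trans (h.kernel.sumDiffOp_mono hx
        (h.kernel.integrableOn_sumDiffIntegrand hm (h.abs_add_le ih.2) x)
        (h.kernel.integrableOn_sumDiffIntegrand h.majorant_measurable h.abs_majorant_le x)
        fun t ht => ?_) (h.supersolution x hx)
      exact h.add_le t _ ht.le (ih.2 t ht.le).1 (ih.2 t ht.le).2

lemma aestronglyMeasurable_iterate (h : IsMonotoneScheme K w l U V C) (n : ℕ) :
    AEStronglyMeasurable (fun t => quasilinearIterate K w l n t +
        w t (quasilinearIterate K w l n t)) (volume.restrict (Ioi 0)) :=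
  ((h.continuousOn_add (h.iterate_mem n).1 fun t ht => ((h.iterate_mem n).2 t ht).1).mono
    Ioi_subset_Ici_self).aestronglyMeasurable measurableSet_Ioi

lemma integrableOn_iterate (h : IsMonotoneScheme K w l U V C) (n : ℕ) (x : ℝ) :
    IntegrableOn (sumDiffIntegrand K (fun t => quasilinearIterate K w l n t +
        w t (quasilinearIterate K w l n t)) x) (Ioi 0) :=
  h.kernel.integrableOn_sumDiffIntegrand (h.aestronglyMeasurable_iterate n)
    (h.abs_add_le (h.iterate_mem n).2) x

lemma iterate_le_succ (h : IsMonotoneScheme K w l U V C) (n : ℕ) :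
    ∀ x, 0 ≤ x → quasilinearIterate K w l n x ≤ quasilinearIterate K w l (n + 1) x := by
  induction n with
  | zero => exact h.subsolution
  | succ n ih =>
    intro x hx
    refine h.kernel.sumDiffOp_mono hx (h.integrableOn_iterate n x)
      (h.integrableOn_iterate (n + 1) x) fun t ht => ?_
    exact add_le_add (ih t ht.le) (h.monotoneOn t ht.le ((h.iterate_mem n).2 t ht.le).1
      ((h.iterate_mem (n + 1)).2 t ht.le).1 (ih t ht.le))

lemma tendsto_iterate (h : IsMonotoneScheme K w l U V C) {x : ℝ} (hx : 0 ≤ x) :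
    Tendsto (fun n => quasilinearIterate K w l n x) atTop (𝓝 (quasilinearLimit K w l x)) :=
  tendsto_atTop_ciSup (monotone_nat_of_le_succ fun n => h.iterate_le_succ n x hx)
    ⟨U x, by rintro _ ⟨n, rfl⟩; exact ((h.iterate_mem n).2 x hx).2⟩

lemma limit_mem (h : IsMonotoneScheme K w l U V C) {x : ℝ} (hx : 0 ≤ x) :
    l x ≤ quasilinearLimit K w l x ∧ quasilinearLimit K w l x ≤ U x :=
  ⟨(monotone_nat_of_le_succ fun n => h.iterate_le_succ n x hx).ge_of_tendsto
      (h.tendsto_iterate hx) 0,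
    le_of_tendsto' (h.tendsto_iterate hx) fun n => ((h.iterate_mem n).2 x hx).2⟩

lemma limit_nonneg (h : IsMonotoneScheme K w l U V C) {x : ℝ} (hx : 0 ≤ x) :
    0 ≤ quasilinearLimit K w l x :=
  (h.lower_nonneg x hx).trans (h.limit_mem hx).1

lemma tendsto_add (h : IsMonotoneScheme K w l U V C) {t : ℝ} (ht : 0 ≤ t) :
    Tendsto (fun n => quasilinearIterate K w l n t + w t (quasilinearIterate K w l n t)) atTop
      (𝓝 (quasilinearLimit K w l t + w t (quasilinearLimit K w l t))) := by
  have hc : ContinuousWithinAt (w t) (Ici 0) (quasilinearLimit K w l t) :=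
    (h.continuousOn (t, quasilinearLimit K w l t) ⟨ht, h.limit_nonneg ht⟩).comp
      (f := fun u => (t, u)) (Continuous.prodMk_right t).continuousWithinAt fun u hu => ⟨ht, hu⟩
  refine (h.tendsto_iterate ht).add (hc.tendsto.comp ?_)
  exact tendsto_nhdsWithin_iff.2
    ⟨h.tendsto_iterate ht, Eventually.of_forall fun n => ((h.iterate_mem n).2 t ht).1⟩

lemma aestronglyMeasurable_limit (h : IsMonotoneScheme K w l U V C) :
    AEStronglyMeasurable (fun t => quasilinearLimit K w l t + w t (quasilinearLimit K w l t))
      (volume.restrict (Ioi 0)) := by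
  refine aestronglyMeasurable_of_tendsto_ae atTop h.aestronglyMeasurable_iterate ?_
  filter_upwards [ae_restrict_mem measurableSet_Ioi] with t ht
  exact h.tendsto_add (le_of_lt ht)

lemma abs_limit_le (h : IsMonotoneScheme K w l U V C) (t : ℝ) (ht : 0 < t) :
    |quasilinearLimit K w l t + w t (quasilinearLimit K w l t)| ≤ C * (1 + |t|) :=
  h.abs_add_le (fun _ hs => ⟨h.limit_nonneg hs, (h.limit_mem hs).2⟩) t ht

/-- The limit of the successive approximations solves the equation, by dominated convergence. -/
lemma limit_eq (h : IsMonotoneScheme K w l U V C) {x : ℝ} (hx : 0 ≤ x) :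
    quasilinearLimit K w l x =
      sumDiffOp K (fun t => quasilinearLimit K w l t + w t (quasilinearLimit K w l t)) x := by
  refine tendsto_nhds_unique ((tendsto_add_atTop_iff_nat 1).2 (h.tendsto_iterate hx)) ?_
  refine tendsto_integral_of_dominated_convergence
    (fun t => C * ((1 + |t|) * kernelMajorant K |x| t))
    (fun n => (h.integrableOn_iterate n x).aestronglyMeasurable)
    ((h.kernel.integrable_kernelMajorant (abs_nonneg x)).const_mul C).integrableOn
    (fun n => ?_) ?_
  · filter_upwards [ae_restrict_mem measurableSet_Ioi] with t ht
    exact h.kernel.abs_sumDiffIntegrand_le le_rfl (h.abs_add_le (h.iterate_mem n).2 t ht)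
  · filter_upwards [ae_restrict_mem measurableSet_Ioi] with t ht
    exact (h.tendsto_add (le_of_lt ht)).const_mul _

lemma isQuasilinearSolution (h : IsMonotoneScheme K w l U V C) :
    IsQuasilinearSolution K w (quasilinearLimit K w l) where
  nonneg _ hx := h.limit_nonneg hx
  continuousOn :=
    (h.kernel.continuous_sumDiffOp h.aestronglyMeasurable_limit h.abs_limit_le).continuousOn.congr
      fun _ hx => h.limit_eq hx
  equation x hx := ⟨h.kernel.integrableOn_sumDiffIntegrand h.aestronglyMeasurable_limit
    h.abs_limit_le x, h.limit_eq hx⟩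

/-- Schemes for the same nonlinearity whose starting points differ by at least a linear function
keep this distance in the limit, since linear functions are fixed by the operator. -/
lemma linear_le_limit_sub (h : IsMonotoneScheme K w l U V C) {l' U' V' : ℝ → ℝ} {C' : ℝ}
    (h' : IsMonotoneScheme K w l' U' V' C') {a : ℝ} (ha : 0 ≤ a)
    (hl : ∀ x, 0 ≤ x → a * x ≤ l x - l' x) {x : ℝ} (hx : 0 ≤ x) :
    a * x ≤ quasilinearLimit K w l x - quasilinearLimit K w l' x := by
  have key : ∀ n x, 0 ≤ x →
      a * x ≤ quasilinearIterate K w l n x - quasilinearIterate K w l' n x := by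
    intro n
    induction n with
    | zero => exact hl
    | succ n ih =>
      intro x hx
      have hlin := h.kernel.integrableOn_sumDiffIntegrand (h := fun t => a * t) (C := a)
        (by fun_prop : Continuous fun t => a * t).aestronglyMeasurable (fun t ht => by
          rw [abs_of_nonneg (by positivity), abs_of_pos ht]; nlinarith) x
      have hi' := h'.integrableOn_iterate n x
      have := h.kernel.sumDiffOp_mono hx (IsAdmissibleKernel.integrableOn_sumDiffIntegrand_add hlin hi')
        (h.integrableOn_iterate n x) fun t ht => by
          have h1 := ih t ht.le
          have h2 := h.monotoneOn t ht.le ((h'.iterate_mem n).2 t ht.le).1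
            ((h.iterate_mem n).2 t ht.le).1 (by nlinarith)
          linarith
      rw [IsAdmissibleKernel.sumDiffOp_add hlin hi', h.kernel.sumDiffOp_linear] at this
      simp only [quasilinearIterate]
      linarith
  exact ge_of_tendsto' ((h.tendsto_iterate hx).sub (h'.tendsto_iterate hx)) fun n => key n x hx

end IsMonotoneScheme

/-! ### Existence of the majorant and of the family of solutions -/

namespace IsAdmissibleNonlinearity

variable {ω : ℝ → ℝ → ℝ} {μ : ℝ → ℝ}

lemma le_sup (hω : IsAdmissibleNonlinearity ω μ) {t u : ℝ} (ht : 0 ≤ t) (hu : 0 ≤ u) :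
    ω t u ≤ μ t :=
  (hω.isLUB t ht).1 ⟨u, hu, rfl⟩

lemma nonneg (hω : IsAdmissibleNonlinearity ω μ) {t u : ℝ} (ht : 0 ≤ t) (hu : 0 ≤ u) :
    0 ≤ ω t u := by
  rw [← hω.zero t ht]
  exact hω.monotoneOn t ht self_mem_Ici hu hu

lemma sup_nonneg (hω : IsAdmissibleNonlinearity ω μ) {t : ℝ} (ht : 0 ≤ t) : 0 ≤ μ t :=
  (hω.nonneg ht le_rfl).trans (hω.le_sup ht le_rfl)

lemma exists_sup_le (hω : IsAdmissibleNonlinearity ω μ) : ∃ B, 0 ≤ B ∧ ∀ t, 0 ≤ t → μ t ≤ B := by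
  obtain ⟨N, hN⟩ := eventually_atTop.1 (hω.sup_tendsto.eventually_le_const zero_lt_one)
  obtain ⟨B, hB⟩ := (isCompact_Icc (a := (0 : ℝ)) (b := N)).bddAbove_image
    (hω.sup_continuousOn.mono Icc_subset_Ici_self)
  refine ⟨max B 1, le_max_of_le_right zero_le_one, fun t ht => ?_⟩
  rcases le_total t N with h | h
  · exact le_max_of_le_left (hB ⟨t, ⟨ht, h⟩, rfl⟩)
  · exact le_max_of_le_right (hN t h)

lemma integrableOn_one_add_mul_sup (hω : IsAdmissibleNonlinearity ω μ) :
    IntegrableOn (fun t => (1 + t) * μ t) (Ioi 0) := by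
  have hm : ContinuousOn (fun t => (1 + t) * μ t) (Ici 0) :=
    (by fun_prop : Continuous fun t : ℝ => 1 + t).continuousOn.mul hω.sup_continuousOn
  rw [← Ioc_union_Ioi_eq_Ioi zero_le_one]
  refine IntegrableOn.union ?_ ?_
  · exact ((hm.mono Icc_subset_Ici_self).integrableOn_Icc (b := 1)).mono_set Ioc_subset_Icc_self
  · refine Integrable.mono' ((hω.sup_moment.mono_set (Ioi_subset_Ioi zero_le_one)).const_mul 2)
      ((hm.mono (Ioi_subset_Ici zero_le_one)).aestronglyMeasurable measurableSet_Ioi) ?_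
    filter_upwards [ae_restrict_mem measurableSet_Ioi] with t ht
    have ht1 : 1 < t := ht
    have h0 := hω.sup_nonneg (zero_le_one.trans ht1.le)
    rw [Real.norm_of_nonneg (by positivity)]
    nlinarith

lemma exists_isMonotoneScheme_sup (hω : IsAdmissibleNonlinearity ω μ) {K : ℝ → ℝ}
    (hK : IsAdmissibleKernel K) :
    ∃ (U V : ℝ → ℝ) (C M : ℝ), IsMonotoneScheme K (fun t _ => μ t) (fun _ => 0) U V C ∧
      ∀ x, U x ≤ M := by
  obtain ⟨B, hB0, hB⟩ := hω.exists_sup_le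
  -- a globally continuous extension of the restriction of `μ` to `[0, ∞)`
  have hc : Continuous fun t => μ (max t 0) :=
    hω.sup_continuousOn.comp_continuous (by fun_prop) fun t => le_max_right t 0
  obtain ⟨U, M, hUm, hU0, hUM, hU⟩ := hK.exists_linear_supersolution hc
    (fun t => hω.sup_nonneg (le_max_right t 0)) (fun t => hB _ (le_max_right t 0))
    (hω.integrableOn_one_add_mul_sup.congr_fun (fun t ht => by
      simp only [max_eq_left (le_of_lt (mem_Ioi.1 ht))]) measurableSet_Ioi)
  refine ⟨U, fun t => U t + μ (max t 0), M + B, M, ?_, hUM⟩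
  exact
    { kernel := hK
      continuousOn := hω.sup_continuousOn.comp continuousOn_fst fun p hp => hp.1
      monotoneOn := fun t _ => monotoneOn_const
      nonneg := fun t _ ht _ => hω.sup_nonneg ht
      lower_continuousOn := continuousOn_const
      lower_nonneg := fun _ _ => le_rfl
      lower_le_upper := fun t _ => hU0 t
      subsolution := fun x hx => setIntegral_nonneg measurableSet_Ioi fun t ht =>
        mul_nonneg (hK.sub_nonneg hx (le_of_lt ht))
          (add_nonneg le_rfl (hω.sup_nonneg (le_of_lt ht)))
      add_le := fun t u ht _ hu => by rw [max_eq_left ht]; linarith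
      majorant_measurable := (hUm.add hc.measurable).aestronglyMeasurable
      majorant_le := fun t _ => by
        have h1 := hUM t
        have h2 := hB _ (le_max_right t 0)
        have h3 : 0 ≤ M + B := add_nonneg ((hU0 t).trans h1) hB0
        nlinarith [mul_nonneg h3 (abs_nonneg t)]
      supersolution := hU }

lemma exists_isLinearMajorant (hω : IsAdmissibleNonlinearity ω μ) {K : ℝ → ℝ}
    (hK : IsAdmissibleKernel K) :
    ∃ ψ, IsLinearMajorant K μ ψ ∧ ∀ x, 0 ≤ x → sumDiffOp K (fun t => ψ t + μ t) x = ψ x := by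
  obtain ⟨U, V, C, M, h, hM⟩ := hω.exists_isMonotoneScheme_sup hK
  obtain ⟨B, hB0, hB⟩ := hω.exists_sup_le
  set ψ := quasilinearLimit K (fun t _ => μ t) (fun _ => 0) with hψ
  have hs := h.isQuasilinearSolution
  have hψM : ∀ x, 0 ≤ x → ψ x ≤ M := fun x hx => (h.limit_mem hx).2.trans (hM x)
  have hM0 : 0 ≤ M := (h.limit_nonneg le_rfl).trans (hψM 0 le_rfl)
  have hiψ := fun x => hK.integrableOn_sumDiffIntegrand (h := ψ) (C := M)
    ((hs.continuousOn.mono Ioi_subset_Ici_self).aestronglyMeasurable measurableSet_Ioi)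
    (fun t ht => by
      rw [abs_of_nonneg (hs.nonneg t ht.le)]
      nlinarith [hψM t ht.le, abs_nonneg t]) x
  have hiμ := fun x => hK.integrableOn_sumDiffIntegrand (h := μ) (C := B)
    ((hω.sup_continuousOn.mono Ioi_subset_Ici_self).aestronglyMeasurable measurableSet_Ioi)
    (fun t ht => by
      rw [abs_of_nonneg (hω.sup_nonneg ht.le)]
      nlinarith [hB t ht.le, abs_nonneg t]) x
  refine ⟨ψ, ⟨hs.nonneg, hs.continuousOn, ⟨M, hψM⟩, sumDiffOp K μ, fun x _ => ⟨hiμ x, rfl⟩,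
    fun x hx => ⟨hiψ x, ?_⟩⟩, fun x hx => (h.limit_eq hx).symm⟩
  have := h.limit_eq hx
  rw [← hψ, IsAdmissibleKernel.sumDiffOp_add (hiψ x) (hiμ x)] at this
  exact sub_eq_of_eq_add this

lemma exists_isMonotoneScheme_linear (hω : IsAdmissibleNonlinearity ω μ) {K ψ : ℝ → ℝ}
    (hK : IsAdmissibleKernel K) (hψ : IsLinearMajorant K μ ψ)
    (hψeq : ∀ x, 0 ≤ x → sumDiffOp K (fun t => ψ t + μ t) x = ψ x) {γ : ℝ} (hγ : 0 < γ) :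
    ∃ (V : ℝ → ℝ) (C : ℝ),
      IsMonotoneScheme K ω (fun t => γ * t) (fun t => γ * t + ψ t) V C := by
  obtain ⟨B, hB0, hB⟩ := hω.exists_sup_le
  obtain ⟨M, hM⟩ := hψ.bounded
  have hM0 : 0 ≤ M := (hψ.nonneg 0 le_rfl).trans (hM 0 le_rfl)
  have hlm : Continuous fun t => γ * t := by fun_prop
  have hlb : ∀ t, 0 < t → |γ * t| ≤ γ * (1 + |t|) := fun t ht => by
    rw [abs_of_pos (by positivity), abs_of_pos ht]; nlinarith
  have hil := fun x => hK.integrableOn_sumDiffIntegrand (h := fun t => γ * t)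
    hlm.aestronglyMeasurable hlb x
  have hψμ : ContinuousOn (fun t => ψ t + μ t) (Ici 0) := hψ.continuousOn.add hω.sup_continuousOn
  have hi := fun x => hK.integrableOn_sumDiffIntegrand (h := fun t => ψ t + μ t) (C := M + B)
    ((hψμ.mono Ioi_subset_Ici_self).aestronglyMeasurable measurableSet_Ioi)
    (fun t ht => by
      rw [abs_of_nonneg (add_nonneg (hψ.nonneg t ht.le) (hω.sup_nonneg ht.le))]
      nlinarith [hB t ht.le, hM t ht.le, abs_nonneg t]) x
  have hlω : ContinuousOn (fun t => γ * t + ω t (γ * t)) (Ici 0) :=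
    hlm.continuousOn.add (hω.continuousOn.comp (continuousOn_id.prodMk hlm.continuousOn)
      fun t ht => ⟨ht, mul_nonneg hγ.le ht⟩)
  have hiω := fun x => hK.integrableOn_sumDiffIntegrand (h := fun t => γ * t + ω t (γ * t))
    (C := γ + B) ((hlω.mono Ioi_subset_Ici_self).aestronglyMeasurable measurableSet_Ioi)
    (fun t ht => by
      have h0 : 0 ≤ γ * t := by positivity
      have h1 := hω.le_sup ht.le h0
      rw [abs_of_nonneg (add_nonneg h0 (hω.nonneg ht.le h0)), abs_of_pos ht]
      nlinarith [hB t ht.le]) x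
  refine ⟨fun t => γ * t + (ψ t + μ t), γ + (M + B), ?_⟩
  exact
    { kernel := hK
      continuousOn := hω.continuousOn
      monotoneOn := hω.monotoneOn
      nonneg := fun t u ht hu => hω.nonneg ht hu
      lower_continuousOn := hlm.continuousOn
      lower_nonneg := fun t ht => mul_nonneg hγ.le ht
      lower_le_upper := fun t ht => by linarith [hψ.nonneg t ht]
      subsolution := fun x hx => by
        refine (hK.sumDiffOp_linear γ x).symm.le.trans
          (hK.sumDiffOp_mono hx (hil x) (hiω x) fun t ht => ?_)
        linarith [hω.nonneg ht.le (mul_nonneg hγ.le ht.le)]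
      add_le := fun t u ht hu huU => by linarith [hω.le_sup ht hu]
      majorant_measurable :=
        ((hlm.continuousOn.add hψμ).mono Ioi_subset_Ici_self).aestronglyMeasurable
          measurableSet_Ioi
      majorant_le := fun t ht => by
        rw [abs_of_nonneg ht]
        nlinarith [hB t ht, hM t ht]
      supersolution := fun x hx => by
        rw [IsAdmissibleKernel.sumDiffOp_add (hil x) (hi x), hK.sumDiffOp_linear, hψeq x hx] }

end IsAdmissibleNonlinearity

/-- A function within bounded distance of `γ x` is asymptotic to `γ x`. -/
lemma tendsto_div_of_linear_bounds {f : ℝ → ℝ} {γ M : ℝ}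
    (h : ∀ x, 0 ≤ x → γ * x ≤ f x ∧ f x ≤ γ * x + M) :
    Tendsto (fun x => f x / x) atTop (𝓝 γ) := by
  have hM : Tendsto (fun x : ℝ => γ + M / x) atTop (𝓝 γ) := by
    simpa using tendsto_const_nhds.add (tendsto_const_nhds.div_atTop tendsto_id (a := M))
  refine tendsto_of_tendsto_of_tendsto_of_le_of_le' tendsto_const_nhds hM ?_ ?_
  · filter_upwards [eventually_gt_atTop 0] with x hx
    exact (le_div_iff₀ hx).2 (h x hx.le).1
  · filter_upwards [eventually_gt_atTop 0] with x hx
    rw [div_le_iff₀ hx, add_mul, div_mul_cancel₀ _ hx.ne']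
    exact (h x hx.le).2

theorem theorem1 (K : ℝ → ℝ) (ω : ℝ → ℝ → ℝ) (μ : ℝ → ℝ)
    (hK : IsAdmissibleKernel K) (hω : IsAdmissibleNonlinearity ω μ) :
    ∃ (ψ : ℝ → ℝ) (f : ℝ → ℝ → ℝ),
      IsLinearMajorant K μ ψ ∧
      (∀ γ, 0 < γ → IsQuasilinearSolution K ω (f γ)) ∧
      (∀ γ, 0 < γ → Tendsto (fun x => f γ x / x) atTop (𝓝 γ)) ∧
      (∀ γ, 0 < γ → ∀ x, 0 ≤ x → γ * x ≤ f γ x ∧ f γ x ≤ γ * x + ψ x) ∧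
      (∀ γ₁ γ₂, 0 < γ₂ → γ₂ < γ₁ → ∀ x, 0 ≤ x →
        (γ₁ - γ₂) * x ≤ f γ₁ x - f γ₂ x) := by
  obtain ⟨ψ, hψ, hψeq⟩ := hω.exists_isLinearMajorant hK
  have scheme := fun γ hγ => hω.exists_isMonotoneScheme_linear hK hψ hψeq (γ := γ) hγ
  refine ⟨ψ, fun γ => quasilinearLimit K ω fun t => γ * t, hψ, fun γ hγ => ?_, fun γ hγ => ?_,
    fun γ hγ x hx => ?_, fun γ₁ γ₂ h₂ h₁₂ x hx => ?_⟩
  · obtain ⟨V, C, h⟩ := scheme γ hγ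
    exact h.isQuasilinearSolution
  · obtain ⟨V, C, h⟩ := scheme γ hγ
    obtain ⟨M, hM⟩ := hψ.bounded
    refine tendsto_div_of_linear_bounds (M := M) fun x hx => ⟨(h.limit_mem hx).1, ?_⟩
    linarith [(h.limit_mem hx).2, hM x hx]
  · obtain ⟨V, C, h⟩ := scheme γ hγ
    exact h.limit_mem hx
  · obtain ⟨V₁, C₁, hs₁⟩ := scheme γ₁ (h₂.trans h₁₂)
    obtain ⟨V₂, C₂, hs₂⟩ := scheme γ₂ h₂
    exact hs₁.linear_le_limit_sub hs₂ (by linarith) (fun y _ => by linarith) hx
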